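/- Let $(I,\mathbb A,m)$ be a measure space with $m(I)<\infty$, write $|J|=m(J)$, and let $\mathcal P=(\mathcal P^k)_{k\ge 0}$ be a $(\lambda_1,\lambda_2)$-good grid, $0<\lambda_1<\lambda_2<1$. This means that the $\mathcal P^k$ are finite families of measurable sets of positive measure, with no set belonging to two different levels, such that: $\mathcal P^0=\{I\}$; the elements of each $\mathcal P^k$ are pairwise disjoint and cover $I$ up to a null set; every $Q\in\mathcal P^{k+1}$ is contained in some $P\in\mathcal P^{k}$; $\lambda_1\le |Q|/|P|\le\lambda_2$ whenever $Q\in\mathcal P^{k+1}$, $P\in\mathcal P^k$ and $Q\subset P$; and $\bigcup_k\mathcal P^k$ generates $\mathbb A$. Functions are complex valued and identified when they agree almost everywhere. Let $0<s<1$. The Besov space $\mathcal B^s_{1,1}(\mathcal P)$ is the set of all $f\in L^1$ that have a representation $f=\sum_{k\ge 0}\sum_{Q\in\mathcal P^k}\sigma_Q a_Q$, where $\sigma_Q\in\mathbb C$, $\sum_k\sum_{Q\in\mathcal P^k}|\sigma_Q|<\infty$, each $a_Q$ is a Souza atom on $Q$ (it vanishes outside $Q$ and is constant on $Q$ with absolute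 value at most $|Q|^{s-1}$), and the series over $k$ converges absolutely in $L^1$. Its norm $|f|_{\mathcal B^s_{1,1}}$ is the infimum of $\sum_k\sum_{Q\in\mathcal P^k}|\sigma_Q|$ over all such representations. Fix $C\ge 1$ and $c\in(0,1)$. A measurable set $\Omega\subset I$ containing some element of $\mathcal P$ is a $(1-s,C,c)$-regular domain if, with $k_0=\min\{k:\exists P\in\mathcal P^k,\ P\subset\Omega\}$, there are families $\mathcal F^k\subset\mathcal P^k$, $k\ge k_0$, such that $\Omega=\bigcup_{k\ge k_0}\bigcup_{Q\in\mathcal F^k}Q$, distinct elements of $\bigcup_{k\ge k_0}\mathcal F^k$ are disjoint, and $$\sum_{Q\in\mathcal F^k}|Q|^{1-s}\le C\,c^{\,k-k_0}\,|\Omega|^{1-s}\qquad\text{for every }k\ge k_0 .$$ Let $\hat{\mathcal W}$ be any family of $(1-s,C,c)$-regular domains with $\bigcup_k\mathcal P^k\subset\hat{\mathcal W}$. Let $B^{1-s}$ be the set of all $f\in L^{1/(1-s)}$ that can be written as $$f=\sum_{i=0}^\infty c_i\,\frac{1_{A_i}}{|A_i|^{1-s}},\qquad A_i\in\hat{\mathcal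 W},\ c_i\in\mathbb C,\ \sum_i|c_i|<\infty,$$ with convergence in $L^{1/(1-s)}$, and let $|f|_{B^{1-s}}$ be the infimum of $\sum_i|c_i|$ over all such representations. **Proposition.** We have $B^{1-s}=\mathcal B^s_{1,1}(\mathcal P)$, and the two norms are equivalent: there are constants $K_1,K_2>0$ such that for every $f$ in this space $$|f|_{B^{1-s}}\le K_1\,|f|_{\mathcal B^s_{1,1}}\qquad\text{and}\qquad |f|_{\mathcal B^s_{1,1}}\le K_2\,|f|_{B^{1-s}} .$$ -/

import Mathlib

open MeasureTheory Filter Topology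
open scoped ENNReal NNReal

namespace GridBesov

/-- A grid in the measure space `(I, m)`: a sequence of finite families `G k` of measurable sets of
positive measure, not all empty, with no set occurring at two levels, and such that the number of
elements of `G k` that meet a given element of `G k` is bounded uniformly. -/
structure IsGrid {I : Type*} [MeasurableSpace I] (m : Measure I) (G : ℕ → Finset (Set I)) :
    Prop where
  measurableSet : ∀ k, ∀ Q ∈ G k, MeasurableSet Q
  measure_pos : ∀ k, ∀ Q ∈ G k, 0 < m Q
  exists_nonempty : ∃ k, (G k).Nonempty
  levels_distinct : ∀ i j, i ≠ j → ∀ P ∈ G i, ∀ Q ∈ G j, P ≠ Q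
  bounded_overlap : ∃ N : ℕ, ∀ k, ∀ Q ∈ G k, {P | P ∈ G k ∧ (P ∩ Q).Nonempty}.ncard ≤ N

/-- A `(lam₁, lam₂)`-good grid, `0 < lam₁ < lam₂ < 1`: a nested sequence of finite partitions (up to
null sets) of `I`, starting from `{I}`, with children of size comparable to their parent, that
generates the `σ`-algebra. -/
structure IsGoodGrid {I : Type*} [mI : MeasurableSpace I] (m : Measure I)
    (G : ℕ → Finset (Set I)) (lam₁ lam₂ : ℝ) : Prop extends IsGrid m G where
  lam₁_pos : 0 < lam₁
  lam₁_lt : lam₁ < lam₂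
  lam₂_lt_one : lam₂ < 1
  zero_level : G 0 = {Set.univ}
  ae_cover : ∀ k, m (⋃ Q ∈ G k, Q)ᶜ = 0
  disjoint : ∀ k, ∀ P ∈ G k, ∀ Q ∈ G k, P ≠ Q → Disjoint P Q
  nested : ∀ k, ∀ Q ∈ G (k + 1), ∃ P ∈ G k, Q ⊆ P
  ratio : ∀ k, ∀ P ∈ G k, ∀ Q ∈ G (k + 1), Q ⊆ P →
    lam₁ ≤ m.real Q / m.real P ∧ m.real Q / m.real P ≤ lam₂
  generates : MeasurableSpace.generateFrom {Q | ∃ k, Q ∈ G k} = mI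

/-- An `(s, p)`-Souza atom supported on `Q`: a function that vanishes outside `Q` and is constant on
`Q`, with value bounded by `|Q| ^ (s - 1 / p)`. -/
def IsSouzaAtom {I : Type*} [MeasurableSpace I] (m : Measure I) (s p : ℝ) (Q : Set I)
    (a : I → ℂ) : Prop :=
  ∃ z : ℂ, (∀ x ∈ Q, a x = z) ∧ (∀ x ∉ Q, a x = 0) ∧ ‖z‖ ≤ m.real Q ^ (s - 1 / p)

/-- The cost `∑ₖ ∑_{Q ∈ G k} |σ_Q|`, for the exponents `p = q = 1`. -/
noncomputable def besovCost {I : Type*} (G : ℕ → Finset (Set I)) (σ : Set I → ℂ) : ℝ≥0∞ :=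
  ∑' k, ∑ Q ∈ G k, ‖σ Q‖ₑ

/-- `f = ∑ₖ ∑_{Q ∈ G k} σ_Q a_Q` is a `𝓑^s_{1,1}`-representation: the `a_Q` are `(s, 1)`-Souza atoms,
the cost is finite, and the series (over the levels `k`) converges absolutely in `L¹`, with sum `f`. -/
structure IsBesovRep {I : Type*} [MeasurableSpace I] (m : Measure I) (G : ℕ → Finset (Set I))
    (s : ℝ) (f : I → ℂ) (σ : Set I → ℂ) (a : Set I → I → ℂ) : Prop where
  atom : ∀ k, ∀ Q ∈ G k, IsSouzaAtom m s 1 Q (a Q)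
  cost_lt_top : besovCost G σ < ∞
  abs_conv : ∑' k, eLpNorm (fun x => ∑ Q ∈ G k, σ Q * a Q x) 1 m < ∞
  tendsto : Tendsto
    (fun n => eLpNorm (fun x => f x - ∑ k ∈ Finset.range n, ∑ Q ∈ G k, σ Q * a Q x) 1 m)
    atTop (𝓝 0)

/-- The space `𝓑^s_{1,1}(G)`, as a set of classes of functions modulo a.e. equality. -/
def besovSpace {I : Type*} [MeasurableSpace I] (m : Measure I) (G : ℕ → Finset (Set I))
    (s : ℝ) : Set (I →ₘ[m] ℂ) :=
  {f | MemLp f 1 m ∧ ∃ σ a, IsBesovRep m G s f σ a}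

/-- The norm of `𝓑^s_{1,1}(G)`: the infimum of the costs of all representations. -/
noncomputable def besovNorm {I : Type*} [MeasurableSpace I] (m : Measure I)
    (G : ℕ → Finset (Set I)) (s : ℝ) (f : I →ₘ[m] ℂ) : ℝ≥0∞ :=
  ⨅ (σ : Set I → ℂ) (a : Set I → I → ℂ) (_ : IsBesovRep m G s f σ a), besovCost G σ

/-- `(α, C, c)`-regular domains. Here `k₀` is the first level with an element contained in `Ω`, and
`Ω` is the disjoint union of families `F k ⊆ G k`, `k ≥ k₀`, whose `α`-sums decay geometrically. -/
def IsRegularDomain {I : Type*} [MeasurableSpace I] (m : Measure I) (G : ℕ → Finset (Set I))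
    (α C c : ℝ) (Ω : Set I) : Prop :=
  MeasurableSet Ω ∧ ∃ k₀ : ℕ, IsLeast {k | ∃ P ∈ G k, P ⊆ Ω} k₀ ∧
    ∃ F : ℕ → Finset (Set I),
      (∀ k ≥ k₀, F k ⊆ G k) ∧
      Ω = ⋃ k ≥ k₀, ⋃ Q ∈ F k, Q ∧
      (∀ i ≥ k₀, ∀ j ≥ k₀, ∀ P ∈ F i, ∀ Q ∈ F j, P ≠ Q → Disjoint P Q) ∧
      ∀ k ≥ k₀, ∑ Q ∈ F k, m.real Q ^ α ≤ C * c ^ (k - k₀) * m.real Ω ^ α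

/-- `f = ∑ᵢ cᵢ 1_{Aᵢ} / |Aᵢ| ^ (1 - s)` with `Aᵢ ∈ W` and `∑ᵢ |cᵢ| < ∞`. The series is understood in
`L^{1/(1-s)}`, where each term has norm at most `|cᵢ|`. -/
structure IsDomainRep {I : Type*} [MeasurableSpace I] (m : Measure I) (W : Set (Set I))
    (s : ℝ) (f : I → ℂ) (c : ℕ → ℂ) (A : ℕ → Set I) : Prop where
  mem : ∀ i, A i ∈ W
  cost_lt_top : ∑' i, ‖c i‖ₑ < ∞
  tendsto : Tendsto
    (fun n => eLpNorm (fun x => f x - ∑ i ∈ Finset.range n,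
        c i * ((A i).indicator (fun _ => (1 : ℂ)) x / ((m.real (A i) ^ (1 - s) : ℝ) : ℂ)))
      (ENNReal.ofReal (1 / (1 - s))) m)
    atTop (𝓝 0)

/-- The space `B^{1-s}` defined by the family `W`, as a set of classes of functions modulo a.e.
equality. -/
def domainSpace {I : Type*} [MeasurableSpace I] (m : Measure I) (W : Set (Set I)) (s : ℝ) :
    Set (I →ₘ[m] ℂ) :=
  {f | MemLp f (ENNReal.ofReal (1 / (1 - s))) m ∧ ∃ c A, IsDomainRep m W s f c A}

/-- The norm of `B^{1-s}`: the infimum of `∑ᵢ |cᵢ|` over all representations. -/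
noncomputable def domainNorm {I : Type*} [MeasurableSpace I] (m : Measure I) (W : Set (Set I))
    (s : ℝ) (f : I →ₘ[m] ℂ) : ℝ≥0∞ :=
  ⨅ (c : ℕ → ℂ) (A : ℕ → Set I) (_ : IsDomainRep m W s f c A), ∑' i, ‖c i‖ₑ

end GridBesov

/-! ### Normalised indicators as vectors of Lᵖ. -/

namespace GridBesov

/-! With p = 1/(1-s), each normalised indicator 1_A/|A|^(1-s) lies in the unit ball of Lᵖ, so
absolutely summable coefficients give unconditionally convergent series and both spaces become
ℓ¹-combinations of such vectors. A Souza atom on Q is a multiple, of modulus at most 1, of the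
normalised indicator of Q, and Q is in W; this gives one inclusion with constant 1
(`exists_isDomainRep_of_isBesovRep`). Conversely, the normalised indicator of a regular domain A is
the sum of those of its cells Q with weights (|Q|/|A|)^(1-s), of total at most ∑ C cʲ = C/(1-c)
(`IsRegularDomain.exists_hasSum`). Substituting and collecting the coefficients on each cell gives
the other inclusion (`exists_isBesovRep_of_isDomainRep`). -/

theorem tendsto_eLpNorm_sub_iff {I : Type*} [MeasurableSpace I] {m : Measure I} {p : ℝ≥0∞}
    [Fact (1 ≤ p)] {f : Lp ℂ p m} {u : ℕ → Lp ℂ p m} {g : ℕ → I → ℂ}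
    (h : ∀ n, u n =ᵐ[m] g n) :
    Tendsto (fun n => eLpNorm (fun x => f x - g n x) p m) atTop (𝓝 0) ↔
      Tendsto u atTop (𝓝 f) := by
  rw [Lp.tendsto_Lp_iff_tendsto_eLpNorm']
  refine iff_of_eq (congrArg (Tendsto · _ _) (funext fun n => ?_))
  rw [eLpNorm_sub_comm]
  exact eLpNorm_congr_ae (by filter_upwards [h n] with x hx; simp [hx])

section UnitIndicator

variable {I : Type*} [MeasurableSpace I] {m : Measure I} [IsFiniteMeasure m] {s : ℝ} {p : ℝ≥0∞}

/-- The function `1_A / |A| ^ (1 - s)`, as an element of `Lᵖ`. -/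
noncomputable def unitIndicator (m : Measure I) [IsFiniteMeasure m] (s : ℝ) (p : ℝ≥0∞) {A : Set I}
    (hA : MeasurableSet A) : Lp ℂ p m :=
  indicatorConstLp p hA (measure_ne_top m A) ((m.real A ^ (1 - s) : ℝ) : ℂ)⁻¹

theorem unitIndicator_coeFn {A : Set I} (hA : MeasurableSet A) :
    unitIndicator m s p hA =ᵐ[m]
      fun x => A.indicator (fun _ => (1 : ℂ)) x / ((m.real A ^ (1 - s) : ℝ) : ℂ) := by
  refine indicatorConstLp_coeFn.trans (.of_forall fun x => ?_)
  by_cases hx : x ∈ A <;> simp [hx]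

/-- Since 1/p = 1-s, the normalisation cancels the norm of the indicator; equality fails only for
null A, where the inverse is 0. -/
theorem norm_unitIndicator_le (hs : s < 1) (hp : p = ENNReal.ofReal (1 / (1 - s))) {A : Set I}
    (hA : MeasurableSet A) : ‖unitIndicator m s p hA‖ ≤ 1 := by
  refine norm_indicatorConstLp_le.trans ?_
  have h : 1 / p.toReal = 1 - s := by
    rw [hp, ENNReal.toReal_ofReal (by have := sub_pos.2 hs; positivity), one_div_one_div]
  rw [h, norm_inv, Complex.norm_real, Real.norm_of_nonneg (by positivity)]
  exact inv_mul_le_one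

theorem smul_unitIndicator_coeFn {A : Set I} (hA : MeasurableSet A) (c : ℂ) :
    ⇑(c • unitIndicator m s p hA) =ᵐ[m] fun x =>
      c * (A.indicator (fun _ => (1 : ℂ)) x / ((m.real A ^ (1 - s) : ℝ) : ℂ)) := by
  filter_upwards [Lp.coeFn_smul c (unitIndicator m s p hA),
    unitIndicator_coeFn (m := m) (s := s) (p := p) hA] with x h1 h2
  rw [h1, Pi.smul_apply, h2, smul_eq_mul]

theorem sum_smul_unitIndicator_coeFn {ι : Type*} {A : ι → Set I} (hA : ∀ i, MeasurableSet (A i))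
    (c : ι → ℂ) (t : Finset ι) :
    ⇑(∑ i ∈ t, c i • unitIndicator m s p (hA i)) =ᵐ[m] fun x =>
      ∑ i ∈ t, c i * ((A i).indicator (fun _ => (1 : ℂ)) x / ((m.real (A i) ^ (1 - s) : ℝ) : ℂ)) := by
  refine (Lp.coeFn_fun_finsetSum t _).trans ?_
  filter_upwards [(ae_ball_iff t.countable_toSet).2 fun i _ =>
    smul_unitIndicator_coeFn (m := m) (s := s) (p := p) (hA i) (c i)] with x hx
  exact Finset.sum_congr rfl hx

theorem summable_smul_unitIndicator [Fact (1 ≤ p)] (hs : s < 1)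
    (hp : p = ENNReal.ofReal (1 / (1 - s))) {ι : Type*} {A : ι → Set I}
    (hA : ∀ i, MeasurableSet (A i)) {c : ι → ℂ} (hc : ∑' i, ‖c i‖ₑ < ∞) :
    Summable fun i => c i • unitIndicator m s p (hA i) := by
  refine Summable.of_norm_bounded (tsum_enorm_ne_top_iff_summable_norm.1 hc.ne) fun i => ?_
  rw [norm_smul]
  exact mul_le_of_le_one_right (norm_nonneg _) (norm_unitIndicator_le hs hp _)

theorem isDomainRep_iff [Fact (1 ≤ p)] (hs : s < 1) (hp : p = ENNReal.ofReal (1 / (1 - s)))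
    {W : Set (Set I)} {A : ℕ → Set I} (hA : ∀ i, MeasurableSet (A i)) {c : ℕ → ℂ} {f : Lp ℂ p m} :
    IsDomainRep m W s f c A ↔ (∀ i, A i ∈ W) ∧ ∑' i, ‖c i‖ₑ < ∞ ∧
      HasSum (fun i => c i • unitIndicator m s p (hA i)) f := by
  have key := tendsto_eLpNorm_sub_iff (f := f)
    fun n => sum_smul_unitIndicator_coeFn (m := m) (s := s) (p := p) hA c (Finset.range n)
  subst hp
  refine ⟨fun h => ⟨h.mem, h.cost_lt_top, ?_⟩, fun h => ⟨h.1, h.2.1, key.2 h.2.2.tendsto_sum_nat⟩⟩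
  exact ((summable_smul_unitIndicator hs rfl hA h.cost_lt_top).hasSum_iff_tendsto_nat).2
    (key.1 h.tendsto)

/-- Pads a countable family to a sequence: outside the image of an injection into ℕ the coefficient
is 0, and the set is some fixed `A i₀` because every term must lie in `W`. -/
theorem exists_isDomainRep [Fact (1 ≤ p)] (hs : s < 1) (hp : p = ENNReal.ofReal (1 / (1 - s)))
    {W : Set (Set I)} (hW : ∀ A ∈ W, MeasurableSet A) {ι : Type*} [Countable ι] [Nonempty ι]
    {A : ι → Set I} (hAW : ∀ i, A i ∈ W) {c : ι → ℂ} (hc : ∑' i, ‖c i‖ₑ < ∞) {f : Lp ℂ p m}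
    (hf : HasSum (fun i => c i • unitIndicator m s p (hW _ (hAW i))) f) :
    ∃ c' A', IsDomainRep m W s f c' A' ∧ ∑' i, ‖c' i‖ₑ = ∑' i, ‖c i‖ₑ := by
  obtain ⟨e, he⟩ := exists_injective_nat ι
  obtain ⟨i₀⟩ := ‹Nonempty ι›
  have hAW' : ∀ n, Function.extend e A (fun _ => A i₀) n ∈ W := by
    intro n
    by_cases h : ∃ i, e i = n
    · obtain ⟨i, rfl⟩ := h
      rw [he.extend_apply]; exact hAW i
    · rw [Function.extend_apply' _ _ _ h]; exact hAW i₀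
  have hcost : ∑' n, ‖Function.extend e c 0 n‖ₑ = ∑' i, ‖c i‖ₑ := by
    rw [← tsum_extend_zero he]
    refine tsum_congr fun n => ?_
    by_cases h : ∃ i, e i = n
    · obtain ⟨i, rfl⟩ := h
      rw [he.extend_apply, he.extend_apply]
    · rw [Function.extend_apply' _ _ _ h, Function.extend_apply' _ _ _ h]; simp
  refine ⟨Function.extend e c 0, _, (isDomainRep_iff hs hp fun n => hW _ (hAW' n)).2
    ⟨hAW', hcost.trans_lt hc, ?_⟩, hcost⟩
  rw [← he.hasSum_iff]
  · convert! hf using 2 with i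
    simp only [Function.comp_apply, he.extend_apply]
  · intro n hn
    rw [Function.extend_apply' _ _ _ (by simpa using hn)]; simp

/-- Finite partial sums are indicators of finite unions; by continuity from below the missing part
has measure tending to 0, which suffices as p < ∞. -/
theorem hasSum_indicatorConstLp_iUnion [Fact (1 ≤ p)] (hp : p ≠ ∞) {ι : Type*} [Countable ι]
    {B : ι → Set I} (hB : ∀ i, MeasurableSet (B i)) (hd : Pairwise (Function.onFun Disjoint B))
    (z : ℂ) :
    HasSum (fun i => indicatorConstLp p (hB i) (measure_ne_top m _) z)
      (indicatorConstLp p (MeasurableSet.iUnion hB) (measure_ne_top m _) z) := by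
  classical
  have hU : ∀ t : Finset ι, MeasurableSet (⋃ i ∈ t, B i) := fun t =>
    t.measurableSet_biUnion fun i _ => hB i
  have hsum : ∀ t : Finset ι, ∑ i ∈ t, indicatorConstLp p (hB i) (measure_ne_top m _) z =
      indicatorConstLp p (hU t) (measure_ne_top m _) z := by
    intro t
    induction t using Finset.induction_on with
    | empty => simp
    | insert a t ha ih =>
      rw [Finset.sum_insert ha, ih, ← indicatorConstLp_disjoint_union]
      · simp only [Finset.set_biUnion_insert]
      · rw [Set.disjoint_iUnion₂_right]
        exact fun i hi => hd fun h => ha (h ▸ hi)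
  rw [HasSum, SummationFilter.unconditional_filter]
  simp only [hsum]
  refine tendsto_indicatorConstLp_set hp ?_
  have hmono : Monotone fun t : Finset ι => ⋃ i ∈ t, B i := fun t u h =>
    Set.biUnion_subset_biUnion_left h
  have h := tendsto_measure_iUnion_atTop (μ := m) hmono
  have hUU : ⋃ t : Finset ι, ⋃ i ∈ t, B i = ⋃ i, B i := (Set.iUnion_eq_iUnion_finset B).symm
  rw [hUU] at h
  have h2 := ENNReal.Tendsto.sub (tendsto_const_nhds (x := m (⋃ i, B i))) h
    (.inl (measure_ne_top m _))
  rw [tsub_self] at h2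
  refine h2.congr fun t => ?_
  have hsub : ⋃ i ∈ t, B i ⊆ ⋃ i, B i := Set.iUnion₂_subset_iUnion _ _
  rw [Set.symmDiff_def, Set.sdiff_eq_empty.2 hsub, Set.empty_union, measure_sdiff hsub
    (hU t).nullMeasurableSet (measure_ne_top m _), Function.comp_apply]

end UnitIndicator

end GridBesov

/-! ### Series over grid cells and Besov representations. -/

namespace GridBesov

variable {I : Type*} {G : ℕ → Finset (Set I)}

/-- The elements of all levels of `G`, indexed by level. -/
abbrev Cell (G : ℕ → Finset (Set I)) : Type _ := Σ k, {Q // Q ∈ G k}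

theorem Cell.tsum_eq (φ : Set I → ℝ≥0∞) : ∑' x : Cell G, φ x.2 = ∑' k, ∑ Q ∈ G k, φ Q := by
  rw [ENNReal.tsum_sigma']
  refine tsum_congr fun k => ?_
  rw [tsum_fintype, Finset.sum_coe_sort (G k) φ]

theorem tendsto_sum_level {E : Type*} [NormedAddCommGroup E] {u : Cell G → E} {g : E}
    (h : HasSum u g) :
    Tendsto (fun n => ∑ k ∈ Finset.range n, ∑ Q : {Q // Q ∈ G k}, u ⟨k, Q⟩) atTop (𝓝 g) :=
  (h.sigma fun _ => hasSum_fintype _).tendsto_sum_nat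

variable [MeasurableSpace I] {m : Measure I} {s : ℝ}

theorem Cell.injective_set (hG : IsGrid m G) :
    Function.Injective fun x : Cell G => (x.2 : Set I) := by
  rintro ⟨j, P, hP⟩ ⟨k, Q, hQ⟩ (rfl : P = Q)
  obtain rfl : j = k := by_contra fun h => hG.levels_distinct j k h P hP P hQ rfl
  rfl

theorem Cell.measurableSet (hG : IsGrid m G) (x : Cell G) : MeasurableSet (x.2 : Set I) :=
  hG.measurableSet x.1 x.2 x.2.2

theorem sum_cell_coeFn {p : ℝ≥0∞} {u : Cell G → Lp ℂ p m} {v : Set I → I → ℂ}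
    (h : ∀ x : Cell G, u x =ᵐ[m] v x.2) (k : ℕ) :
    ⇑(∑ Q : {Q // Q ∈ G k}, u ⟨k, Q⟩) =ᵐ[m] fun x => ∑ Q ∈ G k, v Q x := by
  refine (Lp.coeFn_fun_finsetSum _ _).trans ?_
  filter_upwards [ae_all_iff.2 fun Q : {Q // Q ∈ G k} => h ⟨k, Q⟩] with x hx
  rw [Finset.sum_congr rfl fun Q _ => hx Q, Finset.sum_coe_sort (G k) fun Q => v Q x]

theorem tendsto_eLpNorm_sub_level {p : ℝ≥0∞} [Fact (1 ≤ p)] {u : Cell G → Lp ℂ p m}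
    {v : Set I → I → ℂ} (h : ∀ x : Cell G, u x =ᵐ[m] v x.2) {g : Lp ℂ p m} (hg : HasSum u g) :
    Tendsto (fun n => eLpNorm (fun x => g x - ∑ k ∈ Finset.range n, ∑ Q ∈ G k, v Q x) p m)
      atTop (𝓝 0) := by
  refine (tendsto_eLpNorm_sub_iff fun n => ?_).2 (tendsto_sum_level hg)
  refine (Lp.coeFn_fun_finsetSum _ _).trans ?_
  filter_upwards [ae_all_iff.2 fun k => sum_cell_coeFn h k] with x hx
  exact Finset.sum_congr rfl fun k _ => hx k

variable [IsFiniteMeasure m] {p : ℝ≥0∞}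

theorem exists_eLpNorm_one_le (m : Measure I) [IsFiniteMeasure m] {p : ℝ≥0∞} (hp : 1 ≤ p) :
    ∃ M : ℝ≥0∞, M ≠ ∞ ∧ ∀ f : I → ℂ, AEStronglyMeasurable f m →
      eLpNorm f 1 m ≤ M * eLpNorm f p m := by
  refine ⟨m Set.univ ^ (1 / (1 : ℝ≥0∞).toReal - 1 / p.toReal), ?_, fun f hf =>
    (eLpNorm_le_eLpNorm_mul_rpow_measure_univ hp hf).trans_eq (mul_comm _ _)⟩
  refine ENNReal.rpow_ne_top_of_nonneg ?_ (measure_ne_top m _)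
  rcases eq_or_ne p ∞ with rfl | h
  · simp
  · rw [ENNReal.toReal_one, div_one, sub_nonneg]
    have : 1 ≤ p.toReal := by simpa using ENNReal.toReal_mono h hp
    exact div_le_one_of_le₀ this (by positivity)

theorem tendsto_eLpNorm_one_sub_level [Fact (1 ≤ p)] {u : Cell G → Lp ℂ p m}
    {v : Set I → I → ℂ} (h : ∀ x : Cell G, u x =ᵐ[m] v x.2) {g : Lp ℂ p m} (hg : HasSum u g) :
    Tendsto (fun n => eLpNorm (fun x => g x - ∑ k ∈ Finset.range n, ∑ Q ∈ G k, v Q x) 1 m)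
      atTop (𝓝 0) := by
  obtain ⟨M, hM, hle⟩ := exists_eLpNorm_one_le m (Fact.out : 1 ≤ p)
  have hlim := ENNReal.Tendsto.const_mul (tendsto_eLpNorm_sub_level h hg) (.inr hM)
  rw [mul_zero] at hlim
  refine tendsto_of_tendsto_of_tendsto_of_le_of_le tendsto_const_nhds hlim (fun _ => zero_le)
    fun n => hle _ ?_
  refine (Lp.aestronglyMeasurable g).sub
    (Finset.aestronglyMeasurable_fun_sum _ fun k _ => ?_)
  exact (Lp.aestronglyMeasurable _).congr (sum_cell_coeFn h k)

/-- The normalised indicator of Q is the atom of maximal height |Q|^(s-1). Absolute convergence in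
L¹ follows from the Lᵖ bound on each level and the embedding Lᵖ ⊂ L¹ on a finite measure space. -/
theorem isBesovRep_of_hasSum [Fact (1 ≤ p)] (hs : s < 1) (hp : p = ENNReal.ofReal (1 / (1 - s)))
    (hG : IsGrid m G) {σ : Set I → ℂ} (hσ : besovCost G σ < ∞) {f : Lp ℂ p m}
    (hf : HasSum (fun x : Cell G => σ x.2 • unitIndicator m s p (Cell.measurableSet hG x)) f) :
    IsBesovRep m G s f σ fun Q x =>
      Q.indicator (fun _ => (1 : ℂ)) x / ((m.real Q ^ (1 - s) : ℝ) : ℂ) := by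
  have hu : ∀ x : Cell G, σ x.2 • unitIndicator m s p (Cell.measurableSet hG x) =ᵐ[m] fun y =>
      σ x.2 * ((x.2 : Set I).indicator (fun _ => (1 : ℂ)) y /
        ((m.real x.2 ^ (1 - s) : ℝ) : ℂ)) := by
    exact fun x => smul_unitIndicator_coeFn (Cell.measurableSet hG x) (σ x.2)
  refine ⟨fun k Q hQ => ⟨((m.real Q ^ (1 - s) : ℝ) : ℂ)⁻¹, fun x hx => by simp [hx],
    fun x hx => by simp [hx], ?_⟩, hσ, ?_, tendsto_eLpNorm_one_sub_level hu hf⟩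
  · rw [norm_inv, Complex.norm_real, Real.norm_of_nonneg (by positivity),
      ← Real.rpow_neg measureReal_nonneg, neg_sub, div_one]
  · obtain ⟨M, hM, hle⟩ := exists_eLpNorm_one_le m (Fact.out : 1 ≤ p)
    refine lt_of_le_of_lt ?_ (ENNReal.mul_lt_top hM.lt_top hσ)
    rw [besovCost, ← ENNReal.tsum_mul_left]
    refine ENNReal.tsum_le_tsum fun k => ?_
    rw [← eLpNorm_congr_ae (sum_cell_coeFn hu k)]
    refine (hle _ (Lp.aestronglyMeasurable _)).trans (mul_le_mul_right ?_ M)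
    rw [← Lp.enorm_def, ← Finset.sum_coe_sort (G k) fun Q => ‖σ Q‖ₑ]
    refine (enorm_sum_le _ _).trans (Finset.sum_le_sum fun Q _ => ?_)
    rw [enorm_smul]
    refine mul_le_of_le_one_right' ?_
    simpa using enorm_le_iff_norm_le.2 ((norm_unitIndicator_le (m := m) hs hp (Cell.measurableSet hG ⟨k, Q⟩)).trans_eq
      (norm_one (α := ℂ)).symm)

/-- Absorbing the height of each atom into its coefficient does not increase the cost, and the
resulting series converges in Lᵖ, not merely in L¹. -/
theorem IsBesovRep.exists_hasSum [Fact (1 ≤ p)] (hs : s < 1)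
    (hp : p = ENNReal.ofReal (1 / (1 - s))) (hG : IsGrid m G) {f : I → ℂ} {σ : Set I → ℂ}
    {a : Set I → I → ℂ} (hfm : AEStronglyMeasurable f m) (h : IsBesovRep m G s f σ a) :
    ∃ (b : Cell G → ℂ) (g : Lp ℂ p m), ∑' x, ‖b x‖ₑ ≤ besovCost G σ ∧
      HasSum (fun x => b x • unitIndicator m s p (Cell.measurableSet hG x)) g ∧ g =ᵐ[m] f := by
  choose z hz hz0 hzn using fun x : Cell G => h.atom x.1 x.2 x.2.2
  have hpos : ∀ x : Cell G, 0 < m.real x.2 := fun x =>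
    ENNReal.toReal_pos (hG.measure_pos x.1 x.2 x.2.2).ne' (measure_ne_top m _)
  let b : Cell G → ℂ := fun x => σ x.2 * (z x * ((m.real x.2 ^ (1 - s) : ℝ) : ℂ))
  have hb : ∀ x, ‖b x‖ₑ ≤ ‖σ x.2‖ₑ := by
    intro x
    rw [enorm_le_iff_norm_le, norm_mul]
    refine mul_le_of_le_one_right (norm_nonneg _) ?_
    rw [norm_mul, Complex.norm_real, Real.norm_of_nonneg (by have := hpos x; positivity)]
    calc ‖z x‖ * m.real x.2 ^ (1 - s) ≤ m.real x.2 ^ (s - 1 / 1) * m.real x.2 ^ (1 - s) := by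
          gcongr; exact hzn x
      _ = 1 := by rw [← Real.rpow_add (hpos x)]; simp
  have hcost : ∑' x, ‖b x‖ₑ ≤ besovCost G σ :=
    (ENNReal.tsum_le_tsum hb).trans_eq (Cell.tsum_eq fun Q => ‖σ Q‖ₑ)
  have hu : ∀ x : Cell G, b x • unitIndicator m s p (Cell.measurableSet hG x) =ᵐ[m] fun y =>
      σ x.2 * a x.2 y := by
    intro x
    refine (smul_unitIndicator_coeFn (m := m) (s := s) (p := p) (Cell.measurableSet hG x)
      (b x)).trans (.of_forall fun y => ?_)
    have hne : ((m.real x.2 ^ (1 - s) : ℝ) : ℂ) ≠ 0 :=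
      Complex.ofReal_ne_zero.2 (Real.rpow_pos_of_pos (hpos x) _).ne'
    by_cases hy : y ∈ (x.2 : Set I)
    · simp only [b, hy, Set.indicator_of_mem, hz x y hy]
      field_simp
    · simp [hy, hz0 x y hy]
  obtain ⟨g, hg⟩ := summable_smul_unitIndicator (m := m) hs hp (Cell.measurableSet hG)
    (hcost.trans_lt h.cost_lt_top)
  refine ⟨b, g, hcost, hg, ?_⟩
  have hlim := (tendsto_eLpNorm_one_sub_level (v := fun Q y => σ Q * a Q y) hu hg).add h.tendsto
  rw [add_zero] at hlim
  -- The Lᵖ sum `g` and `f` are L¹ limits of the same level sums.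
  have hzero : eLpNorm (⇑g - f) 1 m = 0 := by
    refine le_antisymm (ge_of_tendsto' hlim fun n => ?_) zero_le
    have hS : AEStronglyMeasurable
        (fun x => ∑ k ∈ Finset.range n, ∑ Q ∈ G k, σ Q * a Q x) m :=
      Finset.aestronglyMeasurable_fun_sum _ fun k _ =>
        (Lp.aestronglyMeasurable _).congr (sum_cell_coeFn (v := fun Q y => σ Q * a Q y) hu k)
    refine le_trans (le_of_eq ?_) (eLpNorm_sub_le ((Lp.aestronglyMeasurable g).sub hS)
      (hfm.sub hS) le_rfl)
    exact congrArg (eLpNorm · 1 m) (by ext x; simp)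
  rw [eLpNorm_eq_zero_iff ((Lp.aestronglyMeasurable g).sub hfm) one_ne_zero] at hzero
  filter_upwards [hzero] with x hx
  exact sub_eq_zero.1 hx

end GridBesov

/-! ### Cell expansions of regular domains and the two comparisons. -/

namespace GridBesov

theorem tsum_ofReal_geometric_shift_le {C c : ℝ} (hC : 1 ≤ C) (hc₀ : 0 < c) (hc₁ : c < 1) (k₀ : ℕ)
    {g : ℕ → ℝ≥0∞} (hlt : ∀ k < k₀, g k = 0)
    (hge : ∀ k ≥ k₀, g k ≤ ENNReal.ofReal (C * c ^ (k - k₀))) :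
    ∑' k, g k ≤ ENNReal.ofReal (C / (1 - c)) := by
  have hsupp : Function.support g ⊆ Set.range fun j => k₀ + j := by
    intro k hk
    by_contra h
    refine hk (hlt k (not_le.1 fun hle => h ⟨k - k₀, by simp [hle]⟩))
  rw [← (add_right_injective k₀).tsum_eq hsupp]
  have hsum := (hasSum_geometric_of_lt_one hc₀.le hc₁).mul_left C
  rw [div_eq_mul_inv, ← hsum.tsum_eq, ENNReal.ofReal_tsum_of_nonneg (fun j => by positivity)
    hsum.summable]
  refine ENNReal.tsum_le_tsum fun j => ?_
  simpa using hge (k₀ + j) (Nat.le_add_right _ _)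

theorem hasSum_tsum_smul_of_hasSum_prod {E ι κ : Type*} [NormedAddCommGroup E] [NormedSpace ℂ E]
    {a : ι × κ → ℂ} {e : κ → E} {g : E} (ha : Summable a)
    (h : HasSum (fun y => a y • e y.2) g) : HasSum (fun x => (∑' i, a (i, x)) • e x) g := by
  have hswap : HasSum (fun y : κ × ι => a (y.2, y.1) • e y.1) g :=
    (Equiv.prodComm κ ι).hasSum_iff.2 h
  refine hswap.prod_fiberwise fun x => HasSum.smul_const ?_ (e x)
  exact (ha.comp_injective (i := fun i => (i, x)) fun i j hij => congrArg Prod.fst hij).hasSum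

variable {I : Type*} [MeasurableSpace I] {m : Measure I}
  {G : ℕ → Finset (Set I)} {s : ℝ} {p : ℝ≥0∞}

theorem domainNorm_le {W : Set (Set I)} {f : I →ₘ[m] ℂ} {c : ℕ → ℂ} {A : ℕ → Set I}
    (h : IsDomainRep m W s f c A) : domainNorm m W s f ≤ ∑' i, ‖c i‖ₑ := by
  unfold domainNorm
  exact iInf₂_le_of_le c A (iInf_le _ h)

theorem besovNorm_le {f : I →ₘ[m] ℂ} {σ : Set I → ℂ} {a : Set I → I → ℂ}
    (h : IsBesovRep m G s f σ a) : besovNorm m G s f ≤ besovCost G σ := by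
  unfold besovNorm
  exact iInf₂_le_of_le σ a (iInf_le _ h)

variable [IsFiniteMeasure m]

theorem IsRegularDomain.exists_hasSum [Fact (1 ≤ p)] (hp : p ≠ ∞) (hG : IsGrid m G) {C c : ℝ}
    (hC : 1 ≤ C) (hc₀ : 0 < c) (hc₁ : c < 1) {A : Set I} (h : IsRegularDomain m G (1 - s) C c A) :
    ∃ d : Cell G → ℂ, ∑' x, ‖d x‖ₑ ≤ ENNReal.ofReal (C / (1 - c)) ∧
      HasSum (fun x => d x • unitIndicator m s p (Cell.measurableSet hG x))
        (unitIndicator m s p h.1) := by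
  classical
  obtain ⟨hA, k₀, ⟨⟨P, hP, hPA⟩, -⟩, F, hFG, hAF, hdisj, hdecay⟩ := h
  -- Nothing is assumed about `F k` for k < k₀, so those levels are left out.
  let D : Set (Set I) := {Q | ∃ k ≥ k₀, Q ∈ F k}
  have hApos : 0 < m.real A := ENNReal.toReal_pos
    ((hG.measure_pos k₀ P hP).trans_le (measure_mono hPA)).ne' (measure_ne_top m _)
  have hlevel : ∀ k, ∀ Q ∈ G k, Q ∈ D → k₀ ≤ k ∧ Q ∈ F k := by
    rintro k Q hQ ⟨j, hj, hQj⟩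
    obtain rfl : k = j :=
      by_contra fun hkj => hG.levels_distinct k j hkj Q hQ Q (hFG j hj hQj) rfl
    exact ⟨hj, hQj⟩
  let φ : Set I → ℂ := fun Q =>
    if Q ∈ D then ((m.real Q ^ (1 - s) / m.real A ^ (1 - s) : ℝ) : ℂ) else 0
  have hφ : ∀ k, ∑ Q ∈ G k, ‖φ Q‖ₑ =
      ∑ Q ∈ G k with Q ∈ D, ENNReal.ofReal (m.real Q ^ (1 - s) / m.real A ^ (1 - s)) := by
    intro k
    rw [Finset.sum_filter]
    refine Finset.sum_congr rfl fun Q _ => ?_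
    by_cases hQ : Q ∈ D
    · simp only [φ, hQ, if_true]
      rw [← ofReal_norm, Complex.norm_real, Real.norm_of_nonneg (by positivity)]
    · simp [φ, hQ]
  refine ⟨fun x => φ x.2, ?_, ?_⟩
  · rw [Cell.tsum_eq fun Q => ‖φ Q‖ₑ]
    refine tsum_ofReal_geometric_shift_le hC hc₀ hc₁ k₀ (fun k hk => ?_) fun k hk => ?_
    · rw [hφ, Finset.filter_false_of_mem fun Q hQ hQD => hk.not_ge (hlevel k Q hQ hQD).1,
        Finset.sum_empty]
    · have hfil : {Q ∈ G k | Q ∈ D} = F k := by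
        ext Q
        rw [Finset.mem_filter]
        exact ⟨fun hQ => (hlevel k Q hQ.1 hQ.2).2, fun hQ => ⟨hFG k hk hQ, k, hk, hQ⟩⟩
      rw [hφ, hfil, ← ENNReal.ofReal_sum_of_nonneg fun Q _ => by positivity, ← Finset.sum_div]
      refine ENNReal.ofReal_le_ofReal ?_
      rw [div_le_iff₀ (by positivity)]
      exact hdecay k hk
  -- Empty sets at the unused cells match the zero coefficients of `φ`, so that one index type
  -- serves for every domain.
  · let B : Cell G → Set I := fun x => if (x.2 : Set I) ∈ D then x.2 else ∅
    have hB : ∀ x, MeasurableSet (B x) := fun x => by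
      by_cases hx : (x.2 : Set I) ∈ D
      · simpa only [B, hx, if_true] using Cell.measurableSet hG x
      · simp only [B, hx, if_false, MeasurableSet.empty]
    have hBd : Pairwise (Function.onFun Disjoint B) := by
      intro x y hxy
      by_cases hx : (x.2 : Set I) ∈ D
      · by_cases hy : (y.2 : Set I) ∈ D
        · simp only [Function.onFun, B, hx, hy, if_true]
          obtain ⟨i, hi, hxi⟩ := hx
          obtain ⟨j, hj, hyj⟩ := hy
          exact hdisj i hi j hj _ hxi _ hyj fun he => hxy (Cell.injective_set hG he)
        · simp [Function.onFun, B, hy]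
      · simp [Function.onFun, B, hx]
    have hBA : ⋃ x, B x = A := by
      ext y
      rw [hAF]
      simp only [Set.mem_iUnion]
      constructor
      · rintro ⟨x, hx⟩
        by_cases hxD : (x.2 : Set I) ∈ D
        · simp only [B, hxD, if_true] at hx
          obtain ⟨k, hk, hxk⟩ := hxD
          exact ⟨k, hk, _, hxk, hx⟩
        · simp [B, hxD] at hx
      · rintro ⟨k, hk, Q, hQ, hy⟩
        have hQD : Q ∈ D := ⟨k, hk, hQ⟩
        exact ⟨⟨k, Q, hFG k hk hQ⟩, by simpa [B, hQD] using hy⟩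
    have hsum := hasSum_indicatorConstLp_iUnion (m := m) hp hB hBd
      ((m.real A ^ (1 - s) : ℝ) : ℂ)⁻¹
    simp only [hBA] at hsum
    have hx : ∀ x : Cell G, φ x.2 • unitIndicator m s p (Cell.measurableSet hG x) =
        indicatorConstLp p (hB x) (measure_ne_top m _) ((m.real A ^ (1 - s) : ℝ) : ℂ)⁻¹ := by
      intro x
      refine Lp.ext ((smul_unitIndicator_coeFn (m := m) (s := s) (p := p)
        (Cell.measurableSet hG x) (φ x.2)).trans
        (.trans (.of_forall fun y => ?_) indicatorConstLp_coeFn.symm))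
      have hQ : ((m.real x.2 ^ (1 - s) : ℝ) : ℂ) ≠ 0 :=
        Complex.ofReal_ne_zero.2 (Real.rpow_pos_of_pos (ENNReal.toReal_pos
          (hG.measure_pos x.1 x.2 x.2.2).ne' (measure_ne_top m _)) _).ne'
      by_cases hxD : (x.2 : Set I) ∈ D
      · by_cases hy : y ∈ (x.2 : Set I)
        · simp only [φ, B, hxD, if_true, hy, Set.indicator_of_mem, Complex.ofReal_div]
          field_simp
        · simp [B, hxD, hy]
      · simp [φ, B, hxD]
    simp only [hx]
    exact hsum

theorem exists_isBesovRep_of_isDomainRep [Fact (1 ≤ p)] (hs : s < 1)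
    (hp : p = ENNReal.ofReal (1 / (1 - s))) (hG : IsGrid m G) {C c : ℝ}
    (hC : 1 ≤ C) (hc₀ : 0 < c) (hc₁ : c < 1) {W : Set (Set I)}
    (hW : ∀ A ∈ W, IsRegularDomain m G (1 - s) C c A) {f : Lp ℂ p m} {b : ℕ → ℂ} {A : ℕ → Set I}
    (h : IsDomainRep m W s f b A) :
    ∃ σ a, IsBesovRep m G s f σ a ∧
      besovCost G σ ≤ ENNReal.ofReal (C / (1 - c)) * ∑' i, ‖b i‖ₑ := by
  have hreg := fun i => hW _ (h.mem i)
  choose d hdc hd using fun i =>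
    (hreg i).exists_hasSum (p := p) (hp ▸ ENNReal.ofReal_ne_top) hG hC hc₀ hc₁
  have hf := ((isDomainRep_iff hs hp fun i => (hreg i).1).1 h).2.2
  have hcost : ∑' y : ℕ × Cell G, ‖b y.1 * d y.1 y.2‖ₑ ≤
      ENNReal.ofReal (C / (1 - c)) * ∑' i, ‖b i‖ₑ := by
    rw [ENNReal.tsum_prod', ← ENNReal.tsum_mul_left]
    refine ENNReal.tsum_le_tsum fun i => ?_
    simp only [enorm_mul]
    rw [ENNReal.tsum_mul_left, mul_comm]
    exact mul_le_mul_left (hdc i) _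
  have hfin : ∑' y : ℕ × Cell G, ‖b y.1 * d y.1 y.2‖ₑ < ∞ :=
    hcost.trans_lt (ENNReal.mul_lt_top ENNReal.ofReal_lt_top h.cost_lt_top)
  have hsumm : Summable fun y : ℕ × Cell G => b y.1 * d y.1 y.2 :=
    (tsum_enorm_ne_top_iff_summable_norm.1 hfin.ne).of_norm
  let τ : Cell G → ℂ := fun x => ∑' i, b i * d i x
  have hτc : ∑' x, ‖τ x‖ₑ ≤ ∑' y : ℕ × Cell G, ‖b y.1 * d y.1 y.2‖ₑ := by
    rw [ENNReal.tsum_prod', ENNReal.tsum_comm]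
    exact ENNReal.tsum_le_tsum fun x => enorm_tsum_le_tsum_enorm
  obtain ⟨g, hg⟩ := summable_smul_unitIndicator (m := m) hs hp
    (fun y : ℕ × Cell G => Cell.measurableSet hG y.2) hfin
  -- Summing the double series over cells first recovers the domain series of `f`.
  have hgf : g = f := by
    refine (hg.prod_fiberwise fun i => ?_).unique hf
    simpa only [mul_smul] using (hd i).const_smul (b i)
  have hτf : HasSum (fun x => τ x • unitIndicator m s p (Cell.measurableSet hG x)) f := by
    rw [← hgf]
    exact hasSum_tsum_smul_of_hasSum_prod (a := fun y : ℕ × Cell G => b y.1 * d y.1 y.2)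
      (e := fun x : Cell G => unitIndicator m s p (Cell.measurableSet hG x)) hsumm hg
  -- Coefficients of a Besov representation are indexed by sets; this is consistent because a set
  -- occurs at only one level.
  let σ : Set I → ℂ := Function.extend (fun x : Cell G => (x.2 : Set I)) τ 0
  have hσ : ∀ x : Cell G, σ x.2 = τ x := fun x => (Cell.injective_set hG).extend_apply τ 0 x
  have hσc : besovCost G σ = ∑' x, ‖τ x‖ₑ := by
    rw [besovCost, ← Cell.tsum_eq fun Q => ‖σ Q‖ₑ]
    exact tsum_congr fun x => by rw [hσ]
  refine ⟨σ, _, isBesovRep_of_hasSum hs hp hG (hσc.trans_lt (hτc.trans_lt hfin)) ?_,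
    hσc.trans_le (hτc.trans hcost)⟩
  simpa only [hσ] using hτf

theorem exists_isDomainRep_of_isBesovRep [Fact (1 ≤ p)] (hs : s < 1)
    (hp : p = ENNReal.ofReal (1 / (1 - s))) (hG : IsGrid m G) {W : Set (Set I)}
    (hGW : ∀ k, ∀ Q ∈ G k, Q ∈ W) (hW : ∀ A ∈ W, MeasurableSet A) {f : I →ₘ[m] ℂ} {σ : Set I → ℂ}
    {a : Set I → I → ℂ} (h : IsBesovRep m G s f σ a) :
    MemLp f p m ∧ ∃ c A, IsDomainRep m W s f c A ∧ ∑' i, ‖c i‖ₑ ≤ besovCost G σ := by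
  obtain ⟨b, g, hb, hg, hgf⟩ := h.exists_hasSum hs hp hG f.aestronglyMeasurable
  obtain rfl : (g : I →ₘ[m] ℂ) = f := AEEqFun.ext hgf
  obtain ⟨k, Q, hQ⟩ := hG.exists_nonempty
  have : Nonempty (Cell G) := ⟨⟨k, Q, hQ⟩⟩
  obtain ⟨c, A, hrep, hcost⟩ := exists_isDomainRep hs hp hW
    (fun x : Cell G => hGW x.1 x.2 x.2.2) (hb.trans_lt h.cost_lt_top) hg
  exact ⟨Lp.memLp g, c, A, hrep, hcost.trans_le hb⟩

end GridBesov

theorem proposition18p1 {I : Type*} [MeasurableSpace I] (m : Measure I) [IsFiniteMeasure m]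
    (G : ℕ → Finset (Set I)) (lam₁ lam₂ : ℝ) (hG : GridBesov.IsGoodGrid m G lam₁ lam₂)
    (s : ℝ) (hs₀ : 0 < s) (hs₁ : s < 1)
    (C c : ℝ) (hC : 1 ≤ C) (hc₀ : 0 < c) (hc₁ : c < 1)
    (W : Set (Set I)) (hGW : ∀ k, ∀ Q ∈ G k, Q ∈ W)
    (hW : ∀ A ∈ W, GridBesov.IsRegularDomain m G (1 - s) C c A) :
    GridBesov.domainSpace m W s = GridBesov.besovSpace m G s ∧
      ∃ K₁ K₂ : ℝ≥0, 0 < K₁ ∧ 0 < K₂ ∧ ∀ f ∈ GridBesov.domainSpace m W s,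
        GridBesov.domainNorm m W s f ≤ K₁ * GridBesov.besovNorm m G s f ∧
        GridBesov.besovNorm m G s f ≤ K₂ * GridBesov.domainNorm m W s f := by
  have hp1 : 1 ≤ ENNReal.ofReal (1 / (1 - s)) := by
    rw [ENNReal.one_le_ofReal, le_div_iff₀ (by linarith)]
    linarith
  have : Fact (1 ≤ ENNReal.ofReal (1 / (1 - s))) := ⟨hp1⟩
  have hgrid := hG.toIsGrid
  have hWm : ∀ A ∈ W, MeasurableSet A := fun A hA => (hW A hA).1
  have hK : 0 < C / (1 - c) := div_pos (by linarith) (by linarith)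
  refine ⟨Set.Subset.antisymm ?_ ?_, 1, (C / (1 - c)).toNNReal, one_pos, Real.toNNReal_pos.2 hK,
    fun f hf => ⟨?_, ?_⟩⟩
  · rintro f ⟨hfp, b, A, hrep⟩
    obtain ⟨σ, a, h, -⟩ := GridBesov.exists_isBesovRep_of_isDomainRep hs₁ rfl hgrid hC hc₀ hc₁ hW
      (f := ⟨f, Lp.mem_Lp_iff_memLp.2 hfp⟩) hrep
    exact ⟨hfp.mono_exponent hp1, σ, a, h⟩
  · rintro f ⟨-, σ, a, h⟩
    obtain ⟨hfp, b, A, hrep, -⟩ :=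
      GridBesov.exists_isDomainRep_of_isBesovRep hs₁ rfl hgrid hGW hWm h
    exact ⟨hfp, b, A, hrep⟩
  · rw [ENNReal.coe_one, one_mul]
    refine le_iInf fun σ => le_iInf fun a => le_iInf fun h => ?_
    obtain ⟨-, b, A, hrep, hcost⟩ :=
      GridBesov.exists_isDomainRep_of_isBesovRep hs₁ rfl hgrid hGW hWm h
    exact (GridBesov.domainNorm_le hrep).trans hcost
  · rw [mul_comm]
    have hK' : ((C / (1 - c)).toNNReal : ℝ≥0∞) ≠ 0 :=
      ENNReal.coe_ne_zero.2 (Real.toNNReal_pos.2 hK).ne'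
    -- The constant moves to the left so that the infimum stands alone and can be bounded
    -- representation by representation.
    rw [← ENNReal.div_le_iff_le_mul (.inl hK') (.inl ENNReal.coe_ne_top)]
    refine le_iInf fun b => le_iInf fun A => le_iInf fun hrep => ?_
    rw [ENNReal.div_le_iff_le_mul (.inl hK') (.inl ENNReal.coe_ne_top), mul_comm]
    obtain ⟨σ, a, h, hcost⟩ := GridBesov.exists_isBesovRep_of_isDomainRep hs₁ rfl hgrid hC hc₀ hc₁
      hW (f := ⟨f, Lp.mem_Lp_iff_memLp.2 hf.1⟩) hrep
    exact (GridBesov.besovNorm_le h).trans hcost
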